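/- Let $M$ be a smooth manifold, $E\to M$ a smooth real vector bundle of finite rank, and $\langle\ ,\ \rangle$ a smooth fiberwise non-degenerate symmetric bilinear form on $E$. Let $\mathcal A=\bigoplus_k\mathcal A^k$ be the graded algebra of functions on the minimal symplectic realization $j^!(T^*[2]E[1])$ of $(E,\langle\ ,\ \rangle)$, where $j:E[1]\to E[1]\oplus E^*[1]$, $u\mapsto(u,\tfrac12\langle u,\cdot\rangle)$, with its canonical Poisson bracket $\{\ ,\ \}$ of degree $-2$; thus $\mathcal A^0=C^\infty(M)$, $\mathcal A^1=\Gamma E$ and $\{u,v\}=\langle u,v\rangle$ for $u,v\in\Gamma E$. A Courant algebroid structure on $(E,\langle\ ,\ \rangle)$ is an element $\Theta\in\mathcal A^3$ with $\{\Theta,\Theta\}=0$, and for such $\Theta$ one sets $\mathrm d_\Theta=\{\Theta,\cdot\}$. Let $\Theta$ be a Courant algebroid structure on $(E,\langle\ ,\ \rangle)$, let $\mathcal N$ be a smooth vector bundle endomorphism of $E$ over the identity of $M$ that is skew-symmetric, i.e. $\langle\mathcal N u,v\rangle+\langle u,\mathcal N v\rangle=0$ for all $u,v$, and let $\widetilde{\mathcal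 N}\in\mathcal A^2$ be the element with $\{u,\widetilde{\mathcal N}\}=\mathcal N(u)$ for all $u\in\Gamma E$ and $\{\widetilde{\mathcal N},f\}=0$ for all $f\in C^\infty(M)$. **Theorem.** The element $\{\widetilde{\mathcal N},\Theta\}\in\mathcal A^3$ is a Courant algebroid structure on $(E,\langle\ ,\ \rangle)$ if and only if $\mathcal N$ is a weak deforming tensor for $\Theta$, that is, $\mathrm d_\Theta\{\{\widetilde{\mathcal N},\Theta\},\widetilde{\mathcal N}\}=0$. When this holds, the structure $\{\widetilde{\mathcal N},\Theta\}$ is compatible with $\Theta$, that is, $\Theta+\{\widetilde{\mathcal N},\Theta\}$ is also a Courant algebroid structure on $(E,\langle\ ,\ \rangle)$. -/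

import Mathlib

open scoped Manifold ContDiff Bundle

/-! ## Functions on the minimal symplectic realization

Let `R` be the algebra of smooth functions on `M`, let `S` be the `R`-module of smooth sections of a
vector bundle `E → M` and let `B` be the pairing of sections.  The graded Poisson algebra `𝒜` of
functions on the minimal symplectic realization of `(E, B)` (Darboux coordinates `q, τ, p` of degrees
`0, 1, 2`, with `{q^i, p_j} = δ^i_j` and `{τ^a, τ^b} = g^{ab}`) satisfies `𝒜⁰ = R`, `𝒜¹ = S`,
and a function of `𝒜` is determined by its iterated Poisson brackets with elements of `𝒜⁰` and
`𝒜¹`, since `q` and `τ` are among these.  An element `X` of `𝒜` is represented here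
by these iterated brackets:
* `X.1 [u₁, …, uᵣ] [f₁, …, fⱼ]` is the part of degree `0` (an element of `R`) of
  `{⋯{{⋯{X, u₁}, ⋯, uᵣ}, f₁}, ⋯, fⱼ}`;
* `X.2 [u₁, …, uᵣ] [f₁, …, fⱼ]` is its part of degree `1` (an element of `S`).
The families that arise so are characterized by the Jacobi identity and the Leibniz rule for
brackets with functions and sections; this is the standard algebraic (cochain) model of the algebra
of functions on the minimal symplectic realization. -/

namespace SymplecticRealization

section Algebraic

set_option linter.unusedSectionVars false

/-- Families of candidates for iterated brackets. -/
abbrev PreFunction (R S : Type*) : Type _ := (List S → List R → R) × (List S → List R → S)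

/-- The bracket `{X, u}` with a section `u`. -/
def bracketSection {R S : Type*} (u : S) (X : PreFunction R S) : PreFunction R S :=
  (fun us fs => X.1 (u :: us) fs, fun us fs => X.2 (u :: us) fs)

/-- The bracket `{X, f}` with a function `f` on the base. -/
def bracketFunction {R S : Type*} (f : R) (X : PreFunction R S) : PreFunction R S :=
  (fun us fs => X.1 us (f :: fs), fun us fs => X.2 us (f :: fs))

/-- A symmetric pairing for which a section is determined by its pairings with all sections. -/
structure IsMetric {R S : Type*} [CommRing R] [AddCommGroup S] [Module R S]
    (B : LinearMap.BilinForm R S) : Prop where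
  symm : ∀ u v, B u v = B v u
  separating : ∀ u, (∀ v, B u v = 0) → u = 0

variable {R S : Type*} [CommRing R] [Algebra ℝ R] [AddCommGroup S] [Module R S]
  {B : LinearMap.BilinForm R S}

/-- The conditions on a family of iterated brackets to come from a function on the minimal
symplectic realization. -/
structure IsFunction (B : LinearMap.BilinForm R S) (X : PreFunction R S) : Prop where
  /-- `{{X, u}, v} + {{X, v}, u} = {X, ⟨u, v⟩}` -/
  swap : ∀ us u v vs fs, X.1 (us ++ u :: v :: vs) fs + X.1 (us ++ v :: u :: vs) fs
    = X.1 (us ++ vs) (B u v :: fs)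
  /-- `{{X, f}, g} = {{X, g}, f}` -/
  perm : ∀ us fs gs, fs.Perm gs → X.1 us fs = X.1 us gs
  /-- `{X, f + g} = {X, f} + {X, g}` -/
  add : ∀ us f g fs, X.1 us ((f + g) :: fs) = X.1 us (f :: fs) + X.1 us (g :: fs)
  /-- `{X, f g} = f {X, g} + g {X, f}` -/
  leibniz : ∀ us f g fs, X.1 us ((f * g) :: fs) = f * X.1 us (g :: fs) + g * X.1 us (f :: fs)
  /-- `{X, c} = 0` for a constant `c` -/
  const : ∀ us (c : ℝ) fs, X.1 us (algebraMap ℝ R c :: fs) = 0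
  /-- an iterated bracket of degree `1` is a section `w`, and its bracket with a section `u` is
  `{w, u} = ⟨w, u⟩` -/
  pairing : ∀ us fs u, B (X.2 us fs) u = X.1 (us ++ [u]) fs

/-- The `R`-module `𝒜ᵏ` of functions of degree `k` on the minimal symplectic realization: the
bracket with a section lowers the degree by `1`, the one with a function on the base by `2`. -/
def Functions (B : LinearMap.BilinForm R S) (k : ℤ) : Submodule R (PreFunction R S) where
  carrier := {X | IsFunction B X ∧
    (∀ us fs, (us.length + 2 * fs.length : ℤ) ≠ k → X.1 us fs = 0) ∧
    (∀ us fs, (us.length + 2 * fs.length : ℤ) ≠ k - 1 → X.2 us fs = 0)}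
  zero_mem' := ⟨⟨by simp, by simp, by simp, by simp, by simp, by simp⟩, by simp, by simp⟩
  add_mem' := by
    rintro α β ⟨hα, a1, a2⟩ ⟨hβ, b1, b2⟩
    refine ⟨⟨?_, ?_, ?_, ?_, ?_, ?_⟩, ?_, ?_⟩
    · intro us u v vs fs
      simp only [Prod.fst_add, Pi.add_apply, ← hα.swap, ← hβ.swap]; abel
    · intro us fs gs h
      simp only [Prod.fst_add, Pi.add_apply, hα.perm us fs gs h, hβ.perm us fs gs h]
    · intro us f g fs
      simp only [Prod.fst_add, Pi.add_apply, hα.add, hβ.add]; abel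
    · intro us f g fs
      simp only [Prod.fst_add, Pi.add_apply, hα.leibniz, hβ.leibniz]; ring
    · intro us c fs
      simp only [Prod.fst_add, Pi.add_apply, hα.const, hβ.const, add_zero]
    · intro us fs u
      simp only [Prod.fst_add, Prod.snd_add, Pi.add_apply, map_add, LinearMap.add_apply,
        hα.pairing, hβ.pairing]
    · intro us fs h
      simp only [Prod.fst_add, Pi.add_apply, a1 us fs h, b1 us fs h, add_zero]
    · intro us fs h
      simp only [Prod.snd_add, Pi.add_apply, a2 us fs h, b2 us fs h, add_zero]
  smul_mem' := by
    rintro c α ⟨hα, a1, a2⟩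
    refine ⟨⟨?_, ?_, ?_, ?_, ?_, ?_⟩, ?_, ?_⟩
    · intro us u v vs fs
      simp only [Prod.smul_fst, Pi.smul_apply, ← hα.swap, smul_add]
    · intro us fs gs h
      simp only [Prod.smul_fst, Pi.smul_apply, hα.perm us fs gs h]
    · intro us f g fs
      simp only [Prod.smul_fst, Pi.smul_apply, hα.add, smul_add]
    · intro us f g fs
      simp only [Prod.smul_fst, Pi.smul_apply, hα.leibniz, smul_eq_mul]; ring
    · intro us d fs
      simp only [Prod.smul_fst, Pi.smul_apply, hα.const, smul_zero]
    · intro us fs u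
      simp only [Prod.smul_fst, Prod.smul_snd, Pi.smul_apply, map_smul, LinearMap.smul_apply,
        hα.pairing]
    · intro us fs h
      simp only [Prod.smul_fst, Pi.smul_apply, a1 us fs h, smul_zero]
    · intro us fs h
      simp only [Prod.smul_snd, Pi.smul_apply, a2 us fs h, smul_zero]

/-- The iterated brackets of degree `0` of the Poisson bracket `{α, β}` with sections and functions,
where `β` has degree `l`.  They are computed from
`{{α, β}, u} = {α, {β, u}} + (-1)ˡ {{α, u}, β}`, `{{α, β}, f} = {α, {β, f}} + {{α, f}, β}` and,
in the end, `{w, w'} = ⟨w, w'⟩` for sections, `{α, f}` for `α` of degree `2`, and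
`{f, β} = -{β, f}` for `β` of degree `2`. -/
def poissonFst (B : LinearMap.BilinForm R S) :
    ℤ → PreFunction R S → PreFunction R S → List S → List R → R
  | _, α, β, [], [] => B (α.2 [] []) (β.2 [] []) + α.1 [] [β.1 [] []] - β.1 [] [α.1 [] []]
  | l, α, β, [], f :: fs =>
      poissonFst B (l - 2) α (bracketFunction f β) [] fs
        + poissonFst B l (bracketFunction f α) β [] fs
  | l, α, β, u :: us, fs =>
      poissonFst B (l - 1) α (bracketSection u β) us fs
        + (l.negOnePow : ℤ) • poissonFst B l (bracketSection u α) β us fs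
  termination_by _ _ _ us fs => us.length + fs.length

/-- The iterated brackets of degree `1` of `{α, β}`; here the recursion ends with `{α, w}` for `α`
of degree `2` and a section `w`, with `{w, β} = -{β, w}`, and with `{α, f}` and `{f, β} = -{β, f}`
for `α`, `β` of degree `3` and a function `f` on the base. -/
def poissonSnd : ℤ → PreFunction R S → PreFunction R S → List S → List R → S
  | _, α, β, [], [] => α.2 [β.2 [] []] [] - β.2 [α.2 [] []] []
      + α.2 [] [β.1 [] []] - β.2 [] [α.1 [] []]
  | l, α, β, [], f :: fs =>
      poissonSnd (l - 2) α (bracketFunction f β) [] fs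
        + poissonSnd l (bracketFunction f α) β [] fs
  | l, α, β, u :: us, fs =>
      poissonSnd (l - 1) α (bracketSection u β) us fs
        + (l.negOnePow : ℤ) • poissonSnd l (bracketSection u α) β us fs
  termination_by _ _ _ us fs => us.length + fs.length

/-- The iterated brackets of degree `0` of the product `α β`, where `β` has degree `l`. -/
def productFst : ℤ → PreFunction R S → PreFunction R S → List S → List R → R
  | _, α, β, [], [] => α.1 [] [] * β.1 [] []
  | l, α, β, [], f :: fs =>
      productFst (l - 2) α (bracketFunction f β) [] fs
        + productFst l (bracketFunction f α) β [] fs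
  | l, α, β, u :: us, fs =>
      productFst (l - 1) α (bracketSection u β) us fs
        + (l.negOnePow : ℤ) • productFst l (bracketSection u α) β us fs
  termination_by _ _ _ us fs => us.length + fs.length

theorem IsFunction.ext (hB : IsMetric B) {X X' : PreFunction R S} (h : IsFunction B X)
    (h' : IsFunction B X') (e : X.1 = X'.1) : X = X' := by
  refine Prod.ext e ?_
  funext us fs
  rw [← sub_eq_zero]
  apply hB.separating
  intro v
  rw [map_sub, LinearMap.sub_apply, h.pairing, h'.pairing, e, sub_self]

theorem isFunction_add {α β : PreFunction R S} (hα : IsFunction B α) (hβ : IsFunction B β) :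
    IsFunction B (α + β) := by
  refine ⟨?_, ?_, ?_, ?_, ?_, ?_⟩
  · intro us u v vs fs
    simp only [Prod.fst_add, Pi.add_apply, ← hα.swap, ← hβ.swap]; abel
  · intro us fs gs h
    simp only [Prod.fst_add, Pi.add_apply, hα.perm us fs gs h, hβ.perm us fs gs h]
  · intro us f g fs
    simp only [Prod.fst_add, Pi.add_apply, hα.add, hβ.add]; abel
  · intro us f g fs
    simp only [Prod.fst_add, Pi.add_apply, hα.leibniz, hβ.leibniz]; ring
  · intro us c fs
    simp only [Prod.fst_add, Pi.add_apply, hα.const, hβ.const, add_zero]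
  · intro us fs u
    simp only [Prod.fst_add, Prod.snd_add, Pi.add_apply, map_add, LinearMap.add_apply,
      hα.pairing, hβ.pairing]

theorem isFunction_smul {α : PreFunction R S} (c : R) (hα : IsFunction B α) :
    IsFunction B (c • α) := by
  refine ⟨?_, ?_, ?_, ?_, ?_, ?_⟩
  · intro us u v vs fs
    simp only [Prod.smul_fst, Pi.smul_apply, ← hα.swap, smul_add]
  · intro us fs gs h
    simp only [Prod.smul_fst, Pi.smul_apply, hα.perm us fs gs h]
  · intro us f g fs
    simp only [Prod.smul_fst, Pi.smul_apply, hα.add, smul_add]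
  · intro us f g fs
    simp only [Prod.smul_fst, Pi.smul_apply, hα.leibniz, smul_eq_mul]; ring
  · intro us d fs
    simp only [Prod.smul_fst, Pi.smul_apply, hα.const, smul_zero]
  · intro us fs u
    simp only [Prod.smul_fst, Prod.smul_snd, Pi.smul_apply, map_smul, LinearMap.smul_apply,
      hα.pairing]

theorem isFunction_zero : IsFunction B (0 : PreFunction R S) :=
  ⟨by simp, by simp, by simp, by simp, by simp, by simp⟩

theorem IsFunction.bracketSection {α : PreFunction R S} (hα : IsFunction B α) (u : S) :
    IsFunction B (bracketSection u α) where
  swap us := hα.swap (u :: us)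
  perm us := hα.perm (u :: us)
  add us := hα.add (u :: us)
  leibniz us := hα.leibniz (u :: us)
  const us := hα.const (u :: us)
  pairing us := hα.pairing (u :: us)

theorem IsFunction.bracketFunction {α : PreFunction R S} (hα : IsFunction B α) (f : R) :
    IsFunction B (bracketFunction f α) where
  swap us u v vs fs := by
    show α.1 _ _ + α.1 _ _ = α.1 _ _
    rw [hα.swap]
    exact hα.perm _ _ _ (List.Perm.swap _ _ _)
  perm us fs gs h := hα.perm us _ _ (h.cons f)
  add us g h fs := by
    show α.1 _ _ = α.1 _ _ + α.1 _ _
    rw [hα.perm us _ _ (List.Perm.swap (g + h) f fs), hα.perm us _ _ (List.Perm.swap g f fs),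
      hα.perm us _ _ (List.Perm.swap h f fs), hα.add]
  leibniz us g h fs := by
    show α.1 _ _ = _ * α.1 _ _ + _ * α.1 _ _
    rw [hα.perm us _ _ (List.Perm.swap (g * h) f fs), hα.perm us _ _ (List.Perm.swap g f fs),
      hα.perm us _ _ (List.Perm.swap h f fs), hα.leibniz]
  const us c fs := by
    show α.1 _ _ = 0
    rw [hα.perm us _ _ (List.Perm.swap _ f fs), hα.const]
  pairing us fs u := hα.pairing us (f :: fs) u

theorem bracketFunction_bracketSection (f : R) (u : S) (X : PreFunction R S) :
    bracketFunction f (bracketSection u X) = bracketSection u (bracketFunction f X) := rfl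

theorem IsFunction.apply_zero {α : PreFunction R S} (hα : IsFunction B α) (us : List S)
    (fs : List R) : α.1 us (0 :: fs) = 0 := by
  have := hα.add us 0 0 fs
  simpa using this

theorem poissonFst_cons_function (l : ℤ) (α β : PreFunction R S) (us : List S) (f : R)
    (fs : List R) :
    poissonFst B l α β us (f :: fs) = poissonFst B (l - 2) α (bracketFunction f β) us fs
      + poissonFst B l (bracketFunction f α) β us fs := by
  induction us generalizing l α β with
  | nil => rw [poissonFst]
  | cons u us ih =>
    simp only [poissonFst, ih, bracketFunction_bracketSection, smul_add]
    have e : (l - 2).negOnePow = l.negOnePow := by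
      rw [Int.negOnePow_sub, Int.negOnePow_even 2 (by decide), mul_one]
    rw [e, show l - 1 - 2 = l - 2 - 1 by ring]
    abel

theorem productFst_cons_function (l : ℤ) (α β : PreFunction R S) (us : List S) (f : R)
    (fs : List R) :
    productFst l α β us (f :: fs) = productFst (l - 2) α (bracketFunction f β) us fs
      + productFst l (bracketFunction f α) β us fs := by
  induction us generalizing l α β with
  | nil => rw [productFst]
  | cons u us ih =>
    simp only [productFst, ih, bracketFunction_bracketSection, smul_add]
    have e : (l - 2).negOnePow = l.negOnePow := by
      rw [Int.negOnePow_sub, Int.negOnePow_even 2 (by decide), mul_one]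
    rw [e, show l - 1 - 2 = l - 2 - 1 by ring]
    abel

theorem poissonFst_zero_right (l : ℤ) {α : PreFunction R S} (hα : IsFunction B α)
    (us : List S) (fs : List R) : poissonFst B l α 0 us fs = 0 := by
  induction us generalizing l α with
  | nil =>
    induction fs generalizing l α with
    | nil => simp [poissonFst, hα.apply_zero]
    | cons f fs ih =>
      rw [poissonFst, ih _ (hα.bracketFunction f),
        show bracketFunction f (0 : PreFunction R S) = 0 from rfl, ih _ hα, add_zero]
  | cons u us ih =>
    rw [poissonFst, ih _ (hα.bracketSection u),
      show bracketSection u (0 : PreFunction R S) = 0 from rfl, ih _ hα, smul_zero, add_zero]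

theorem poissonFst_zero_left (l : ℤ) {β : PreFunction R S} (hβ : IsFunction B β)
    (us : List S) (fs : List R) : poissonFst B l 0 β us fs = 0 := by
  induction us generalizing l β with
  | nil =>
    induction fs generalizing l β with
    | nil => simp [poissonFst, hβ.apply_zero]
    | cons f fs ih =>
      rw [poissonFst, ih _ (hβ.bracketFunction f),
        show bracketFunction f (0 : PreFunction R S) = 0 from rfl, ih _ hβ, add_zero]
  | cons u us ih =>
    rw [poissonFst, ih _ (hβ.bracketSection u),
      show bracketSection u (0 : PreFunction R S) = 0 from rfl, ih _ hβ, smul_zero, add_zero]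

theorem poissonFst_add_right (l : ℤ) {α : PreFunction R S} (β β' : PreFunction R S)
    (hα : IsFunction B α) (us : List S) (fs : List R) :
    poissonFst B l α (β + β') us fs = poissonFst B l α β us fs + poissonFst B l α β' us fs := by
  induction us generalizing l α β β' with
  | nil =>
    induction fs generalizing l α β β' with
    | nil => simp [poissonFst, hα.add]; ring
    | cons f fs ih =>
      simp only [poissonFst]
      rw [ih _ _ _ (hα.bracketFunction f), show bracketFunction f (β + β')
        = bracketFunction f β + bracketFunction f β' from rfl, ih _ _ _ hα]
      ring
  | cons u us ih =>
    simp only [poissonFst]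
    rw [ih _ _ _ (hα.bracketSection u), show bracketSection u (β + β')
      = bracketSection u β + bracketSection u β' from rfl, ih _ _ _ hα, smul_add]
    ring

theorem poissonFst_add_left (l : ℤ) (α α' : PreFunction R S) {β : PreFunction R S}
    (hβ : IsFunction B β) (us : List S) (fs : List R) :
    poissonFst B l (α + α') β us fs = poissonFst B l α β us fs + poissonFst B l α' β us fs := by
  induction us generalizing l α α' β with
  | nil =>
    induction fs generalizing l α α' β with
    | nil => simp [poissonFst, hβ.add]; ring
    | cons f fs ih =>
      simp only [poissonFst]
      rw [ih _ _ _ (hβ.bracketFunction f), show bracketFunction f (α + α')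
        = bracketFunction f α + bracketFunction f α' from rfl, ih _ _ _ hβ]
      ring
  | cons u us ih =>
    simp only [poissonFst]
    rw [ih _ _ _ (hβ.bracketSection u), show bracketSection u (α + α')
      = bracketSection u α + bracketSection u α' from rfl, ih _ _ _ hβ, smul_add]
    ring

theorem poissonFst_smul_right (l : ℤ) {α : PreFunction R S} (β : PreFunction R S) (g : R)
    (hα : IsFunction B α) (us : List S) (fs : List R) :
    poissonFst B l α (g • β) us fs = g * poissonFst B l α β us fs
      + productFst l (bracketFunction g α) β us fs := by
  induction us generalizing l α β with
  | nil =>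
    induction fs generalizing l α β with
    | nil => simp [poissonFst, productFst, hα.leibniz, bracketFunction]; ring
    | cons f fs ih =>
      simp only [poissonFst, productFst]
      rw [ih _ _ (hα.bracketFunction f), show bracketFunction f (g • β)
        = g • bracketFunction f β from rfl, ih _ _ hα]
      have e : productFst l (bracketFunction f (bracketFunction g α)) β [] fs
          = productFst l (bracketFunction g (bracketFunction f α)) β [] fs := by
        have hs : ∀ us gs, α.1 us (g :: f :: gs) = α.1 us (f :: g :: gs) := fun us gs =>
          hα.perm us _ _ (List.Perm.swap _ _ _)
        clear ih
        have key : ∀ (l : ℤ) (X X' β : PreFunction R S), X.1 = X'.1 → ∀ us fs,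
            productFst l X β us fs = productFst l X' β us fs := by
          intro l X X' β h us
          induction us generalizing l X X' β with
          | nil =>
            intro fs
            induction fs generalizing l X X' β with
            | nil => simp [productFst, h]
            | cons k fs ih =>
              simp only [productFst]
              rw [ih _ _ _ _ h, ih l (bracketFunction k X) (bracketFunction k X') β
                (by simp [bracketFunction, h])]
          | cons w us ih =>
            intro fs
            simp only [productFst]
            rw [ih _ _ _ _ h, ih l (bracketSection w X) (bracketSection w X') β
              (by simp [bracketSection, h])]
        refine key _ _ _ _ ?_ _ _
        funext us gs
        exact hs us gs
      rw [e]
      ring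
  | cons u us ih =>
    simp only [poissonFst, productFst]
    rw [ih _ _ (hα.bracketSection u), show bracketSection u (g • β)
      = g • bracketSection u β from rfl, ih _ _ hα, bracketFunction_bracketSection]
    simp only [zsmul_eq_mul]
    ring

theorem poissonFst_smul_left (hB : IsMetric B) (l : ℤ) (α : PreFunction R S)
    {β : PreFunction R S} (g : R) (hβ : IsFunction B β) (us : List S) (fs : List R) :
    poissonFst B l (g • α) β us fs = g * poissonFst B l α β us fs
      - productFst (l - 2) α (bracketFunction g β) us fs := by
  induction us generalizing l α β with
  | nil =>
    induction fs generalizing l α β with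
    | nil => simp [poissonFst, productFst, hβ.leibniz, bracketFunction]; ring
    | cons f fs ih =>
      simp only [poissonFst, productFst]
      rw [ih _ _ (hβ.bracketFunction f), show bracketFunction f (g • α)
        = g • bracketFunction f α from rfl, ih _ _ hβ,
        show bracketFunction f (bracketFunction g β) = bracketFunction g (bracketFunction f β) from
          IsFunction.ext hB ((hβ.bracketFunction g).bracketFunction f)
            ((hβ.bracketFunction f).bracketFunction g)
            (by funext us gs; exact hβ.perm us _ _ (List.Perm.swap _ _ _))]
      ring
  | cons u us ih =>
    simp only [poissonFst, productFst]
    have e : (l - 2).negOnePow = l.negOnePow := by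
      rw [Int.negOnePow_sub, Int.negOnePow_even 2 (by decide), mul_one]
    rw [ih _ _ (hβ.bracketSection u), show bracketSection u (g • α)
      = g • bracketSection u α from rfl, ih _ _ hβ, bracketFunction_bracketSection, e,
      show l - 1 - 2 = l - 2 - 1 by ring]
    simp only [zsmul_eq_mul]
    ring

theorem bracketSection_swap (hB : IsMetric B) {β : PreFunction R S} (hβ : IsFunction B β)
    (u v : S) : bracketSection v (bracketSection u β) + bracketSection u (bracketSection v β)
      = bracketFunction (B u v) β :=
  IsFunction.ext hB
    (isFunction_add ((hβ.bracketSection u).bracketSection v)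
      ((hβ.bracketSection v).bracketSection u)) (hβ.bracketFunction _)
    (by funext us fs; exact hβ.swap [] u v us fs)

theorem poissonFst_swap (hB : IsMetric B) (l : ℤ) {α β : PreFunction R S} (hα : IsFunction B α)
    (hβ : IsFunction B β) (us : List S) (u v : S) (vs : List S) (fs : List R) :
    poissonFst B l α β (us ++ u :: v :: vs) fs + poissonFst B l α β (us ++ v :: u :: vs) fs
      = poissonFst B l α β (us ++ vs) (B u v :: fs) := by
  induction us generalizing l α β with
  | nil =>
    rw [List.nil_append, List.nil_append, List.nil_append, poissonFst_cons_function,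
      ← bracketSection_swap hB hα, ← bracketSection_swap hB hβ, poissonFst_add_left _ _ _ hβ,
      poissonFst_add_right _ _ _ hα]
    simp only [poissonFst]
    have e : ((l - 1).negOnePow : ℤ) = -(l.negOnePow : ℤ) := by
      rw [Int.negOnePow_sub, Int.negOnePow_one]; simp
    rw [e, show l - 1 - 1 = l - 2 by ring]
    have e2 : ((l.negOnePow : ℤ) : R) * ((l.negOnePow : ℤ) : R) = 1 := by
      rw [← Int.cast_mul, ← Units.val_mul, ← Int.negOnePow_add, Int.negOnePow_even _ ⟨l, rfl⟩]
      simp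
    simp only [zsmul_eq_mul, Int.cast_neg]
    linear_combination (poissonFst B l (bracketSection v (bracketSection u α)) β vs fs +
      poissonFst B l (bracketSection u (bracketSection v α)) β vs fs) * e2
  | cons w us ih =>
    simp only [List.cons_append, poissonFst]
    rw [← ih _ (hα.bracketSection w) hβ, ← ih _ hα (hβ.bracketSection w), smul_add]
    ring

theorem poissonFst_perm (hB : IsMetric B) (l : ℤ) {α β : PreFunction R S} (hα : IsFunction B α)
    (hβ : IsFunction B β) (us : List S) (fs gs : List R) (h : fs.Perm gs) :
    poissonFst B l α β us fs = poissonFst B l α β us gs := by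
  have sw : ∀ {X : PreFunction R S}, IsFunction B X → ∀ f g,
      bracketFunction f (bracketFunction g X) = bracketFunction g (bracketFunction f X) := by
    intro X hX f g
    exact IsFunction.ext hB ((hX.bracketFunction g).bracketFunction f)
            ((hX.bracketFunction f).bracketFunction g)
            (by funext us gs; exact hX.perm us _ _ (List.Perm.swap _ _ _))
  induction h generalizing l α β with
  | nil => rfl
  | cons f _ ih =>
    rw [poissonFst_cons_function, poissonFst_cons_function, ih _ hα (hβ.bracketFunction f),
      ih _ (hα.bracketFunction f) hβ]
  | swap f g fs =>
    simp only [poissonFst_cons_function]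
    rw [sw hα, sw hβ]
    ring
  | trans _ _ ih1 ih2 => rw [ih1 _ hα hβ, ih2 _ hα hβ]

theorem bracketFunction_add (hB : IsMetric B) {β : PreFunction R S} (hβ : IsFunction B β)
    (f g : R) : bracketFunction (f + g) β = bracketFunction f β + bracketFunction g β :=
  IsFunction.ext hB (hβ.bracketFunction _)
    (isFunction_add (hβ.bracketFunction f) (hβ.bracketFunction g))
    (by funext us fs; exact hβ.add us f g fs)

theorem bracketFunction_mul (hB : IsMetric B) {β : PreFunction R S} (hβ : IsFunction B β)
    (f g : R) : bracketFunction (f * g) β = f • bracketFunction g β + g • bracketFunction f β :=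
  IsFunction.ext hB (hβ.bracketFunction _)
    (isFunction_add (isFunction_smul f (hβ.bracketFunction g))
      (isFunction_smul g (hβ.bracketFunction f)))
    (by funext us fs; exact hβ.leibniz us f g fs)

theorem bracketFunction_const (hB : IsMetric B) {β : PreFunction R S} (hβ : IsFunction B β)
    (c : ℝ) : bracketFunction (algebraMap ℝ R c) β = 0 :=
  IsFunction.ext hB (hβ.bracketFunction _) isFunction_zero
    (by funext us fs; exact hβ.const us c fs)

theorem poissonFst_add (hB : IsMetric B) (l : ℤ) {α β : PreFunction R S} (hα : IsFunction B α)
    (hβ : IsFunction B β) (us : List S) (f g : R) (fs : List R) :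
    poissonFst B l α β us ((f + g) :: fs)
      = poissonFst B l α β us (f :: fs) + poissonFst B l α β us (g :: fs) := by
  simp only [poissonFst_cons_function]
  rw [bracketFunction_add hB hα, bracketFunction_add hB hβ, poissonFst_add_left _ _ _ hβ,
    poissonFst_add_right _ _ _ hα]
  ring

theorem poissonFst_leibniz (hB : IsMetric B) (l : ℤ) {α β : PreFunction R S}
    (hα : IsFunction B α) (hβ : IsFunction B β) (us : List S) (f g : R) (fs : List R) :
    poissonFst B l α β us ((f * g) :: fs)
      = f * poissonFst B l α β us (g :: fs) + g * poissonFst B l α β us (f :: fs) := by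
  simp only [poissonFst_cons_function]
  rw [bracketFunction_mul hB hα, bracketFunction_mul hB hβ, poissonFst_add_left _ _ _ hβ,
    poissonFst_add_right _ _ _ hα, poissonFst_smul_right _ _ _ hα, poissonFst_smul_right _ _ _ hα,
    poissonFst_smul_left hB _ _ _ hβ, poissonFst_smul_left hB _ _ _ hβ]
  ring

theorem poissonFst_const (hB : IsMetric B) (l : ℤ) {α β : PreFunction R S} (hα : IsFunction B α)
    (hβ : IsFunction B β) (us : List S) (c : ℝ) (fs : List R) :
    poissonFst B l α β us (algebraMap ℝ R c :: fs) = 0 := by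
  rw [poissonFst_cons_function, bracketFunction_const hB hα, bracketFunction_const hB hβ,
    poissonFst_zero_left _ hβ, poissonFst_zero_right _ hα, add_zero]

theorem mem_functions_iff {k : ℤ} {X : PreFunction R S} : X ∈ Functions B k ↔ IsFunction B X ∧
    (∀ us fs, (us.length + 2 * fs.length : ℤ) ≠ k → X.1 us fs = 0) ∧
    (∀ us fs, (us.length + 2 * fs.length : ℤ) ≠ k - 1 → X.2 us fs = 0) := Iff.rfl

theorem bracketSection_mem {k : ℤ} {X : PreFunction R S} (h : X ∈ Functions B k) (u : S) :
    bracketSection u X ∈ Functions B (k - 1) := by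
  refine ⟨h.1.bracketSection u, fun us fs hk => h.2.1 _ _ ?_, fun us fs hk => h.2.2 _ _ ?_⟩ <;>
  · rw [List.length_cons]; push_cast; omega

theorem bracketFunction_mem {k : ℤ} {X : PreFunction R S} (h : X ∈ Functions B k) (f : R) :
    bracketFunction f X ∈ Functions B (k - 2) := by
  refine ⟨h.1.bracketFunction f, fun us fs hk => h.2.1 _ _ ?_, fun us fs hk => h.2.2 _ _ ?_⟩ <;>
  · rw [List.length_cons]; push_cast; omega

theorem poissonFst_degree {k l : ℤ} {α β : PreFunction R S} (hα : α ∈ Functions B k)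
    (hβ : β ∈ Functions B l) (us : List S) (fs : List R)
    (h : (us.length + 2 * fs.length : ℤ) ≠ k + l - 2) : poissonFst B l α β us fs = 0 := by
  induction us generalizing k l α β with
  | nil =>
    induction fs generalizing k l α β with
    | nil =>
      simp only [List.length_nil] at h
      rw [poissonFst]
      have h1 : B (α.2 [] []) (β.2 [] []) = 0 := by
        by_cases hk : k = 1
        · rw [hβ.2.2 [] [] (by simp only [List.length_nil]; omega), map_zero]
        · rw [hα.2.2 [] [] (by simp only [List.length_nil]; omega), map_zero,
            LinearMap.zero_apply]
      have h2 : α.1 [] [β.1 [] []] = 0 := by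
        by_cases hk : k = 2
        · rw [hβ.2.1 [] [] (by simp only [List.length_nil]; omega), hα.1.apply_zero]
        · rw [hα.2.1 [] [_] (by simp only [List.length_nil, List.length_cons]; omega)]
      have h3 : β.1 [] [α.1 [] []] = 0 := by
        by_cases hk : l = 2
        · rw [hα.2.1 [] [] (by simp only [List.length_nil]; omega), hβ.1.apply_zero]
        · rw [hβ.2.1 [] [_] (by simp only [List.length_nil, List.length_cons]; omega)]
      rw [h1, h2, h3]; simp
    | cons f fs ih =>
      rw [List.length_cons] at h; push_cast at h
      rw [poissonFst, ih hα (bracketFunction_mem hβ f) (by omega),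
        ih (bracketFunction_mem hα f) hβ (by omega), add_zero]
  | cons u us ih =>
    rw [List.length_cons] at h; push_cast at h
    rw [poissonFst, ih hα (bracketSection_mem hβ u) (by omega),
      ih (bracketSection_mem hα u) hβ (by omega), smul_zero, add_zero]

theorem poissonFst_pairing (hB : IsMetric B) {k l : ℤ} {α β : PreFunction R S}
    (hα : α ∈ Functions B k) (hβ : β ∈ Functions B l) (us : List S) (fs : List R) (u : S) :
    B (poissonSnd l α β us fs) u = poissonFst B l α β (us ++ [u]) fs := by
  induction us generalizing k l α β with
  | nil =>
    induction fs generalizing k l α β with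
    | nil =>
      have e0 := hβ.1.swap [] (α.2 [] []) u [] []
      have e1 := hα.1.swap [] (β.2 [] []) u [] []
      simp only [List.nil_append] at e0 e1
      have p0 := hβ.1.pairing [u] [] (α.2 [] [])
      have p1 := hα.1.pairing [u] [] (β.2 [] [])
      have q0 := hβ.1.pairing [] [] u
      have q1 := hα.1.pairing [] [] u
      simp only [List.nil_append, List.cons_append] at p0 p1 q0 q1
      have s0 : α.1 [β.2 [u] []] [] = β.1 [u, α.2 [] []] [] := by
        rw [← p0, hB.symm, hα.1.pairing, List.nil_append]
      simp only [List.nil_append, poissonFst, poissonSnd, map_add, map_sub, LinearMap.add_apply,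
        LinearMap.sub_apply, hα.1.pairing, hβ.1.pairing, bracketSection, List.cons_append]
      rw [s0, ← q0, ← q1]
      have c1 : ((l.negOnePow : ℤ) : R) * α.1 [u, β.2 [] []] [] = -α.1 [u, β.2 [] []] [] := by
        by_cases hl : l = 1
        · subst hl; simp
        · have hz : β.2 [] [] = 0 := hβ.2.2 [] [] (by simp only [List.length_nil]; omega)
          rw [← p1, hz, map_zero, mul_zero, neg_zero]
      have c2 : ((l.negOnePow : ℤ) : R) * α.1 [u] [β.1 [] []] = α.1 [u] [β.1 [] []] := by
        by_cases hl : l = 0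
        · subst hl; simp
        · rw [hβ.2.1 [] [] (by simp only [List.length_nil]; omega), hα.1.apply_zero]; simp
      have c3 : ((l.negOnePow : ℤ) : R) * β.1 [] [B (α.2 [] []) u]
          = β.1 [] [B (α.2 [] []) u] := by
        by_cases hl : l = 2
        · subst hl; rw [Int.negOnePow_even 2 (by decide)]; simp
        · rw [hβ.2.1 [] [_] (by simp only [List.length_nil, List.length_cons]; omega)]; simp
      simp only [zsmul_eq_mul]
      rw [q0, q1]
      rw [q1] at e0 c3
      rw [q0] at e1
      linear_combination e1 - e0 - c1 - c2 + c3
    | cons f fs ih =>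
      simp only [List.nil_append] at ih ⊢
      rw [poissonFst_cons_function, ← ih hα (bracketFunction_mem hβ f),
        ← ih (bracketFunction_mem hα f) hβ, poissonSnd, map_add, LinearMap.add_apply]
  | cons w us ih =>
    rw [List.cons_append, poissonFst, poissonSnd, map_add, LinearMap.add_apply,
      ih hα (bracketSection_mem hβ w), map_zsmul, LinearMap.smul_apply,
      ih (bracketSection_mem hα w) hβ]

theorem poissonSnd_degree (hB : IsMetric B) {k l : ℤ} {α β : PreFunction R S}
    (hα : α ∈ Functions B k) (hβ : β ∈ Functions B l) (us : List S) (fs : List R)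
    (h : (us.length + 2 * fs.length : ℤ) ≠ k + l - 2 - 1) : poissonSnd l α β us fs = 0 := by
  apply hB.separating
  intro v
  rw [poissonFst_pairing hB hα hβ]
  apply poissonFst_degree hα hβ
  rw [List.length_append]; simp only [List.length_singleton]; push_cast; omega

/-- The Poisson bracket `𝒜ᵏ × 𝒜ˡ → 𝒜ᵏ⁺ˡ⁻²`. -/
def poisson (hB : IsMetric B) {k l m : ℤ} (α : Functions B k) (β : Functions B l)
    (h : m = k + l - 2 := by norm_num) : Functions B m :=
  ⟨(poissonFst B l α β, poissonSnd l (α : PreFunction R S) β), by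
    obtain ⟨α, hα⟩ := α
    obtain ⟨β, hβ⟩ := β
    subst h
    exact ⟨⟨poissonFst_swap hB l hα.1 hβ.1, poissonFst_perm hB l hα.1 hβ.1,
      poissonFst_add hB l hα.1 hβ.1, poissonFst_leibniz hB l hα.1 hβ.1,
      poissonFst_const hB l hα.1 hβ.1, poissonFst_pairing hB hα hβ⟩,
      poissonFst_degree hα hβ, poissonSnd_degree hB hα hβ⟩⟩

/-- The identification of a section `w` with an element of `𝒜¹`, by `{w, u} = ⟨w, u⟩`. -/
def ofSection (B : LinearMap.BilinForm R S) (w : S) : Functions B 1 :=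
  ⟨(fun us fs => match us, fs with
      | [u], [] => B w u
      | _, _ => 0,
    fun us fs => match us, fs with
      | [], [] => w
      | _, _ => 0), by
    refine ⟨⟨?_, ?_, ?_, ?_, ?_, ?_⟩, ?_, ?_⟩
    · rintro (_ | ⟨a, _ | ⟨b, us⟩⟩) u v vs fs <;> simp
    · intro us fs gs h
      rcases fs with _ | ⟨f, fs⟩
      · rw [List.nil_perm.1 h]
      · rcases gs with _ | ⟨g, gs⟩
        · simp at h
        · simp
    · simp
    · simp
    · simp
    · rintro (_ | ⟨a, us⟩) (_ | ⟨f, fs⟩) u <;> simp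
    · rintro (_ | ⟨a, _ | ⟨b, us⟩⟩) (_ | ⟨f, fs⟩) h <;> simp at h ⊢
    · rintro (_ | ⟨a, us⟩) (_ | ⟨f, fs⟩) h <;> simp at h ⊢⟩

/-- The element `Ñ` of `𝒜²` defined by a skew-symmetric endomorphism `N`: it is characterized by
`{u, Ñ} = N u` for all sections `u`.  Its iterated brackets are `{Ñ, u} = -N u`,
`{{Ñ, u}, v} = -⟨N u, v⟩` and `{Ñ, f} = 0`. -/
def ofSkew (B : LinearMap.BilinForm R S) (N : S → S) (hN : ∀ u v, B (N u) v + B u (N v) = 0)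
    (hB : IsMetric B) : Functions B 2 :=
  ⟨(fun us fs => match us, fs with
      | [u, v], [] => -B (N u) v
      | _, _ => 0,
    fun us fs => match us, fs with
      | [u], [] => -N u
      | _, _ => 0), by
    refine ⟨⟨?_, ?_, ?_, ?_, ?_, ?_⟩, ?_, ?_⟩
    · rintro (_ | ⟨a, _ | ⟨b, us⟩⟩) u v (_ | ⟨c, vs⟩) (_ | ⟨f, fs⟩) <;> simp
      rw [hB.symm (N v) u]
      linear_combination -hN u v
    · intro us fs gs h
      rcases fs with _ | ⟨f, fs⟩
      · rw [List.nil_perm.1 h]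
      · rcases gs with _ | ⟨g, gs⟩
        · simp at h
        · simp
    · simp
    · simp
    · simp
    · rintro (_ | ⟨a, _ | ⟨b, us⟩⟩) (_ | ⟨f, fs⟩) u <;> simp
    · rintro (_ | ⟨a, _ | ⟨b, _ | ⟨c, us⟩⟩⟩) (_ | ⟨f, fs⟩) h <;> simp at h ⊢
    · rintro (_ | ⟨a, _ | ⟨b, us⟩⟩) (_ | ⟨f, fs⟩) h <;> simp at h ⊢⟩

theorem poisson_ofSection_ofSkew (hB : IsMetric B) (N : S → S)
    (hN : ∀ u v, B (N u) v + B u (N v) = 0) (u : S) :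
    poisson hB (ofSection B u) (ofSkew B N hN hB) = ofSection B (N u) := by
  apply Subtype.ext
  have key : (poisson hB (ofSection B u) (ofSkew B N hN hB) (m := 1)).1.2
      = (ofSection B (N u)).1.2 := by
    funext us fs
    by_cases h : us = [] ∧ fs = []
    · obtain ⟨rfl, rfl⟩ := h
      simp [poisson, poissonSnd, ofSection, ofSkew]
    · have h' : (us.length + 2 * fs.length : ℤ) ≠ 1 - 1 := by
        intro e
        apply h
        constructor <;> apply List.length_eq_zero_iff.1 <;> omega
      rw [(poisson hB (ofSection B u) (ofSkew B N hN hB) (m := 1)).2.2.2 us fs h',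
        (ofSection B (N u)).2.2.2 us fs h']
  refine Prod.ext ?_ key
  funext us fs
  rcases List.eq_nil_or_concat us with rfl | ⟨us, v, rfl⟩
  · rw [(poisson hB (ofSection B u) (ofSkew B N hN hB) (m := 1)).2.2.1 [] fs
      (by simp only [List.length_nil]; omega), (ofSection B (N u)).2.2.1 [] fs
      (by simp only [List.length_nil]; omega)]
  · rw [List.concat_eq_append,
      ← (poisson hB (ofSection B u) (ofSkew B N hN hB) (m := 1)).2.1.pairing,
      ← (ofSection B (N u)).2.1.pairing, key]

end Algebraic

noncomputable section Smooth

open Bundle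

variable {n : ℕ} {M : Type*} [TopologicalSpace M] [ChartedSpace (EuclideanSpace ℝ (Fin n)) M]
  {F : Type*} [NormedAddCommGroup F] [NormedSpace ℝ F]
  {E : M → Type*} [TopologicalSpace (TotalSpace F E)] [∀ x, TopologicalSpace (E x)]
  [∀ x, AddCommGroup (E x)] [∀ x, Module ℝ (E x)] [FiberBundle F E] [VectorBundle ℝ F E]

/-- The smooth sections of a vector bundle form a module over the smooth functions. -/
instance instModuleSections : Module C^∞⟮𝓡 n, M; ℝ⟯ Cₛ^∞⟮𝓡 n; F, E⟯ where
  smul f s := ⟨fun x => f x • s x, ContMDiff.smul_section f.contMDiff s.contMDiff⟩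
  one_smul s := ContMDiffSection.ext fun x => one_smul ℝ (s x)
  mul_smul f g s := ContMDiffSection.ext fun x => mul_smul (f x) (g x) (s x)
  smul_zero f := ContMDiffSection.ext fun x => smul_zero (f x)
  smul_add f s t := ContMDiffSection.ext fun x => smul_add (f x) (s x) (t x)
  add_smul f g s := ContMDiffSection.ext fun x => add_smul (f x) (g x) (s x)
  zero_smul s := ContMDiffSection.ext fun x => zero_smul ℝ (s x)

variable (n F E) in
/-- A smooth fiberwise non-degenerate symmetric bilinear form on a vector bundle. -/
structure FiberMetric where
  form : ∀ x, LinearMap.BilinForm ℝ (E x)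
  symm : ∀ x u v, form x u v = form x v u
  nondegenerate : ∀ x u, (∀ v, form x u v = 0) → u = 0
  smooth : ∀ u v : Cₛ^∞⟮𝓡 n; F, E⟯, ContMDiff (𝓡 n) 𝓘(ℝ, ℝ) ∞ fun x => form x (u x) (v x)

namespace FiberMetric

variable (g : FiberMetric n F E)

/-- The function `⟨u, v⟩` on `M`, for sections `u` and `v`. -/
def pairing : LinearMap.BilinForm C^∞⟮𝓡 n, M; ℝ⟯ Cₛ^∞⟮𝓡 n; F, E⟯ :=
  LinearMap.mk₂ _ (fun u v => ⟨fun x => g.form x (u x) (v x), g.smooth u v⟩)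
    (fun u u' v => ContMDiffMap.ext fun x => by
      show g.form x (u x + u' x) (v x) = _
      rw [map_add]; rfl)
    (fun f u v => ContMDiffMap.ext fun x => by
      show g.form x (f x • u x) (v x) = _
      rw [map_smul]; rfl)
    (fun u v v' => ContMDiffMap.ext fun x => by
      show g.form x (u x) (v x + v' x) = _
      rw [map_add]; rfl)
    (fun f u v => ContMDiffMap.ext fun x => by
      show g.form x (u x) (f x • v x) = _
      rw [map_smul]; rfl)

theorem pairing_apply (u v : Cₛ^∞⟮𝓡 n; F, E⟯) (x : M) :
    g.pairing u v x = g.form x (u x) (v x) := rfl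

/-- Through every vector of the bundle passes a smooth section. -/
theorem exists_section [T2Space M] [IsManifold (𝓡 n) ∞ M] [ContMDiffVectorBundle ∞ F E (𝓡 n)] (x : M) (w : E x) :
    ∃ s : Cₛ^∞⟮𝓡 n; F, E⟯, s x = w := by
  obtain ⟨t, ht, hs⟩ := FiberBundle.exists_contMDiffOn_extend (𝓡 n) F (k := ∞) w
  obtain ⟨o, hot, ho, hxo⟩ := mem_nhds_iff.1 ht
  obtain ⟨f, hf⟩ := ((SmoothBumpFunction.nhds_basis_tsupport (I := 𝓡 n) x).mem_iff).1
    (ho.mem_nhds hxo)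
  refine ⟨⟨(f : M → ℝ) • FiberBundle.extend F w,
    ContMDiffOn.smul_section_of_tsupport f.contMDiff.contMDiffOn ho hf.2 (hs.mono hot)⟩, ?_⟩
  show f x • FiberBundle.extend F w x = w
  rw [f.eq_one, one_smul]
  simp

theorem isMetric [T2Space M] [IsManifold (𝓡 n) ∞ M] [ContMDiffVectorBundle ∞ F E (𝓡 n)] :
     IsMetric g.pairing where
  symm u v := ContMDiffMap.ext fun x => g.symm x _ _
  separating u hu := by
    ext x
    apply g.nondegenerate x
    intro w
    obtain ⟨s, rfl⟩ := exists_section (n := n) (F := F) x w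
    exact congrArg (fun h : C^∞⟮𝓡 n, M; ℝ⟯ => h x) (hu s)

/-- The space `𝒜ᵏ` of functions of degree `k` on the minimal symplectic realization of `(E, g)`. -/
abbrev A (k : ℤ) : Submodule C^∞⟮𝓡 n, M; ℝ⟯ (PreFunction C^∞⟮𝓡 n, M; ℝ⟯ Cₛ^∞⟮𝓡 n; F, E⟯) :=
  Functions g.pairing k

variable [T2Space M] [IsManifold (𝓡 n) ∞ M] [ContMDiffVectorBundle ∞ F E (𝓡 n)] {g}

/-- The canonical Poisson bracket `{α, β}` of degree `-2`. -/
abbrev bracket {k l m : ℤ} (α : g.A k) (β : g.A l) (h : m = k + l - 2 := by norm_num) : g.A m :=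
  poisson g.isMetric α β h

/-- `Θ ∈ 𝒜³` is a Courant algebroid structure on `(E, g)` if `{Θ, Θ} = 0`. -/
def IsCourantStructure (Θ : g.A 3) : Prop :=
  (bracket Θ Θ : g.A 4) = 0

/-- The operator `d_Θ = {Θ, ·}`. -/
def differential (Θ : g.A 3) {k : ℤ} (α : g.A k) : g.A (k + 1) :=
  bracket Θ α (by ring)

/-- Two Courant algebroid structures are compatible if their sum is a Courant algebroid
structure. -/
def Compatible (Θ Θ' : g.A 3) : Prop :=
  IsCourantStructure (Θ + Θ')

end FiberMetric

/-- A (smooth) endomorphism of the vector bundle `E` that is skew-symmetric for `g`. -/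
structure SkewEndomorphism (g : FiberMetric n F E) where
  toFun : ∀ x, E x →ₗ[ℝ] E x
  smooth : ∀ u : Cₛ^∞⟮𝓡 n; F, E⟯, ContMDiff (𝓡 n) ((𝓡 n).prod 𝓘(ℝ, F)) ∞
    fun x => TotalSpace.mk' F x (toFun x (u x))
  skew : ∀ x u v, g.form x (toFun x u) v + g.form x u (toFun x v) = 0

namespace SkewEndomorphism

variable {g : FiberMetric n F E} (N : SkewEndomorphism g)

/-- The map induced by the endomorphism on sections. -/
def onSections (u : Cₛ^∞⟮𝓡 n; F, E⟯) : Cₛ^∞⟮𝓡 n; F, E⟯ :=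
  ⟨fun x => N.toFun x (u x), N.smooth u⟩

variable [T2Space M] [IsManifold (𝓡 n) ∞ M] [ContMDiffVectorBundle ∞ F E (𝓡 n)]

/-- The function `Ñ ∈ 𝒜²` associated with the skew-symmetric endomorphism `N`. -/
def tilde : g.A 2 :=
  ofSkew g.pairing N.onSections (fun u v => ContMDiffMap.ext fun x => N.skew x (u x) (v x))
    g.isMetric

/-- `{u, Ñ} = N u` for all sections `u`. -/
theorem bracket_section_tilde (u : Cₛ^∞⟮𝓡 n; F, E⟯) :
    FiberMetric.bracket (ofSection g.pairing u) N.tilde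
      = ofSection g.pairing (N.onSections u) :=
  poisson_ofSection_ofSkew g.isMetric _ _ u

/-- The element `{Ñ, Θ}` of `𝒜³`. -/
def deformation (Θ : g.A 3) : g.A 3 :=
  FiberMetric.bracket N.tilde Θ

/-- `N` is a weak deforming tensor for `Θ` if `{{Ñ, Θ}, Ñ}` is a `d_Θ`-cocycle. -/
def IsWeakDeforming (Θ : g.A 3) : Prop :=
  FiberMetric.differential Θ
    (FiberMetric.bracket (FiberMetric.bracket N.tilde Θ : g.A 3) N.tilde : g.A 3) = 0

end SkewEndomorphism

end Smooth

end SymplecticRealization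

/-!
The bracket on `𝒜` is a graded Lie bracket of degree `-2`: it is bilinear, graded antisymmetric
(`poisson_antisymm`) and satisfies the graded Jacobi identity (`poisson_jacobi`). Since `Ñ` has even
degree, `{Ñ, ·}` is a derivation of the bracket. Write `Θ' = {Ñ, Θ}`. Applying this derivation to
`{Θ, Θ} = 0` gives `2 {Θ, Θ'} = 0` (`poisson_deformation_eq_zero`), and applying it to
`{Θ, Θ'} = 0` gives `{Θ', Θ'} = -{Θ, {Ñ, Θ'}} = {Θ, {Θ', Ñ}}` (`poisson_deformation_self`). The right
side is the obstruction to `N` being weak deforming, which is the equivalence; and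
`{Θ + Θ', Θ + Θ'} = {Θ', Θ'}`, which is the compatibility.

Antisymmetry and the Jacobi identity are proved by induction on the lists of sections and functions
with which the two sides are bracketed. The recursion that defines the bracket says that these
operations are derivations, so both identities reduce to total degree `0`, where only finitely many
combinations of degrees contribute.
-/

namespace SymplecticRealization

section GradedLie

set_option linter.unusedSectionVars false

variable {R S : Type*} [CommRing R] [Algebra ℝ R] [AddCommGroup S] [Module R S]
  {B : LinearMap.BilinForm R S}

/-! ### Linearity -/

theorem poissonFst_neg_right (l : ℤ) {α : PreFunction R S} (β : PreFunction R S)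
    (hα : IsFunction B α) (us : List S) (fs : List R) :
    poissonFst B l α (-β) us fs = -poissonFst B l α β us fs := by
  rw [eq_neg_iff_add_eq_zero, ← poissonFst_add_right l _ _ hα, neg_add_cancel,
    poissonFst_zero_right l hα]

theorem poissonFst_neg_left (l : ℤ) (α : PreFunction R S) {β : PreFunction R S}
    (hβ : IsFunction B β) (us : List S) (fs : List R) :
    poissonFst B l (-α) β us fs = -poissonFst B l α β us fs := by
  rw [eq_neg_iff_add_eq_zero, ← poissonFst_add_left l _ _ hβ, neg_add_cancel,
    poissonFst_zero_left l hβ]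

theorem poissonFst_units_smul_right (l : ℤ) (c : ℤˣ) {α : PreFunction R S} (β : PreFunction R S)
    (hα : IsFunction B α) (us : List S) (fs : List R) :
    poissonFst B l α ((c : ℤ) • β) us fs = (c : ℤ) • poissonFst B l α β us fs := by
  rcases Int.units_eq_one_or c with rfl | rfl <;> simp [poissonFst_neg_right l _ hα]

theorem poissonFst_units_smul_left (l : ℤ) (c : ℤˣ) (α : PreFunction R S) {β : PreFunction R S}
    (hβ : IsFunction B β) (us : List S) (fs : List R) :
    poissonFst B l ((c : ℤ) • α) β us fs = (c : ℤ) • poissonFst B l α β us fs := by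
  rcases Int.units_eq_one_or c with rfl | rfl <;> simp [poissonFst_neg_left l _ hβ]

/-! ### Graded antisymmetry -/

theorem negOnePow_mul_negOnePow {A : Type*} [CommRing A] (j : ℤ) :
    ((j.negOnePow : ℤ) : A) * ((j.negOnePow : ℤ) : A) = 1 := by
  rw [← Int.cast_mul, ← Units.val_mul, ← Int.negOnePow_add, Int.negOnePow_even _ ⟨j, rfl⟩]
  simp

/-- Graded antisymmetry `{α, β} = -(-1)ᵏˡ {β, α}`. Bracketing with sections and functions reduces it
to total degree `0`, where it is the symmetry of `B` or the convention `{f, β} = -{β, f}`. -/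
theorem poissonFst_antisymm (hB : IsMetric B) {k l : ℤ} {α β : PreFunction R S}
    (hα : α ∈ Functions B k) (hβ : β ∈ Functions B l) (us : List S) (fs : List R) :
    poissonFst B l α β us fs = -(((k * l).negOnePow : ℤ) • poissonFst B k β α us fs) := by
  induction us generalizing k l α β with
  | nil =>
    induction fs generalizing k l α β with
    | nil =>
      simp only [poissonFst]
      by_cases hk : k = 1 ∧ l = 1
      · obtain ⟨rfl, rfl⟩ := hk
        have h1 : α.1 [] [β.1 [] []] = 0 := hα.2.1 _ _ (by simp)
        have h2 : β.1 [] [α.1 [] []] = 0 := hβ.2.1 _ _ (by simp)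
        simp [h1, h2, hB.symm]
      · have h1 : B (α.2 [] []) (β.2 [] []) = 0 := by
          by_cases hk1 : k = 1
          · rw [hβ.2.2 [] [] (by simp only [List.length_nil]; omega), map_zero]
          · rw [hα.2.2 [] [] (by simp only [List.length_nil]; omega), map_zero,
              LinearMap.zero_apply]
        rw [hB.symm (β.2 [] []), h1]
        by_cases hk2 : k = 2
        · subst hk2
          rw [Int.negOnePow_even _ (even_two_mul l)]
          simp
        by_cases hl2 : l = 2
        · subst hl2
          rw [Int.negOnePow_even _ (even_two.mul_left k)]
          simp
        rw [hα.2.1 [] [_] (by simp only [List.length_nil, List.length_cons]; omega),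
          hβ.2.1 [] [_] (by simp only [List.length_nil, List.length_cons]; omega)]
        simp
    | cons f fs ih =>
      simp only [poissonFst]
      rw [ih hα (bracketFunction_mem hβ f), ih (bracketFunction_mem hα f) hβ,
        show k * (l - 2) = k * l - 2 * k by ring, show (k - 2) * l = k * l - 2 * l by ring,
        Int.negOnePow_sub, Int.negOnePow_sub, Int.negOnePow_even _ (even_two_mul l),
        Int.negOnePow_even _ (even_two_mul k), mul_one, smul_add]
      ring
  | cons u us ih =>
    simp only [poissonFst]
    rw [ih hα (bracketSection_mem hβ u), ih (bracketSection_mem hα u) hβ,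
      show k * (l - 1) = k * l - k by ring, show (k - 1) * l = k * l - l by ring,
      Int.negOnePow_sub, Int.negOnePow_sub]
    simp only [zsmul_eq_mul, Units.val_mul, Int.cast_mul]
    linear_combination -(((k * l).negOnePow : ℤ) : R)
      * poissonFst B (k - 1) β (bracketSection u α) us fs
      * negOnePow_mul_negOnePow (A := R) l

/-! ### The graded Jacobi identity -/

/-- The family of iterated brackets of `{α, β}`, where `β` has degree `l`. It is the underlying
family of `poisson`, available without a proof that `α` and `β` are homogeneous functions. -/
def poissonFamily (B : LinearMap.BilinForm R S) (l : ℤ) (α β : PreFunction R S) :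
    PreFunction R S :=
  (poissonFst B l α β, poissonSnd l α β)

theorem poissonFamily_mem (hB : IsMetric B) {k l : ℤ} {α β : PreFunction R S}
    (hα : α ∈ Functions B k) (hβ : β ∈ Functions B l) :
    poissonFamily B l α β ∈ Functions B (k + l - 2) :=
  (poisson hB ⟨α, hα⟩ ⟨β, hβ⟩ rfl).2

theorem bracketSection_poissonFamily (l : ℤ) (α β : PreFunction R S) (u : S) :
    bracketSection u (poissonFamily B l α β) = poissonFamily B (l - 1) α (bracketSection u β)
      + (l.negOnePow : ℤ) • poissonFamily B l (bracketSection u α) β := by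
  refine Prod.ext ?_ ?_ <;> funext us fs
  · simp [bracketSection, poissonFamily, poissonFst]
  · simp [bracketSection, poissonFamily, poissonSnd]

theorem poissonSnd_cons_function (l : ℤ) (α β : PreFunction R S) (us : List S) (f : R)
    (fs : List R) :
    poissonSnd l α β us (f :: fs) = poissonSnd (l - 2) α (bracketFunction f β) us fs
      + poissonSnd l (bracketFunction f α) β us fs := by
  induction us generalizing l α β with
  | nil => rw [poissonSnd]
  | cons u us ih =>
    simp only [poissonSnd, ih, bracketFunction_bracketSection, smul_add]
    have e : (l - 2).negOnePow = l.negOnePow := by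
      rw [Int.negOnePow_sub, Int.negOnePow_even 2 (by decide), mul_one]
    rw [e, show l - 1 - 2 = l - 2 - 1 by ring]
    abel

theorem bracketFunction_poissonFamily (l : ℤ) (α β : PreFunction R S) (f : R) :
    bracketFunction f (poissonFamily B l α β) = poissonFamily B (l - 2) α (bracketFunction f β)
      + poissonFamily B l (bracketFunction f α) β := by
  refine Prod.ext ?_ ?_ <;> funext us fs
  · simp [bracketFunction, poissonFamily, poissonFst_cons_function]
  · simp [bracketFunction, poissonFamily, poissonSnd_cons_function]

theorem eq_zero_of_mem_functions_neg (hB : IsMetric B) {k : ℤ} {X : PreFunction R S}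
    (hX : X ∈ Functions B k) (hk : k < 0) : X = 0 :=
  IsFunction.ext hB hX.1 isFunction_zero <| by
    funext us fs
    exact hX.2.1 us fs (by omega)

theorem poissonFamily_zero_right (hB : IsMetric B) {k l : ℤ} {α : PreFunction R S}
    (hα : α ∈ Functions B k) : poissonFamily B l α 0 = 0 :=
  IsFunction.ext hB (poissonFamily_mem hB hα (zero_mem _)).1 isFunction_zero <| by
    funext us fs
    exact poissonFst_zero_right l hα.1 us fs

theorem poissonFamily_zero_left (hB : IsMetric B) {l : ℤ} {β : PreFunction R S}
    (hβ : β ∈ Functions B l) : poissonFamily B l 0 β = 0 :=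
  IsFunction.ext hB (poissonFamily_mem hB (zero_mem (Functions B 0)) hβ).1 isFunction_zero <| by
    funext us fs
    exact poissonFst_zero_left l hβ.1 us fs

theorem IsFunction.apply_neg {X : PreFunction R S} (hX : IsFunction B X) (us : List S) (f : R)
    (fs : List R) : X.1 us (-f :: fs) = -X.1 us (f :: fs) := by
  rw [eq_neg_iff_add_eq_zero, ← hX.add, neg_add_cancel, hX.apply_zero]

/-- The graded Jacobi identity in total degree `0`. The degrees are then `0, 0, 4`, `0, 1, 3`,
`0, 2, 2` or `1, 1, 2` in some order. The terms cancel by `IsFunction.perm` for an element of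
degree `4` and two functions, by the symmetry of `B` for degree `3`, and by `IsFunction.swap` for
an element of degree `2` and two sections. -/
theorem poissonFst_jacobi_nil (hB : IsMetric B) {k l m : ℤ} {α β γ : PreFunction R S}
    (hα : α ∈ Functions B k) (hβ : β ∈ Functions B l) (hγ : γ ∈ Functions B m) :
    poissonFst B (l + m - 2) α (poissonFamily B m β γ) [] []
      = poissonFst B m (poissonFamily B l α β) γ [] []
        + ((k * l).negOnePow : ℤ) •
          poissonFst B (k + m - 2) β (poissonFamily B m α γ) [] [] := by
  by_cases hs : k + l + m = 4
  swap
  · rw [poissonFst_degree hα (poissonFamily_mem hB hβ hγ) _ _ (by simp; omega),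
      poissonFst_degree hβ (poissonFamily_mem hB hα hγ) _ _ (by simp; omega),
      poissonFst_degree (poissonFamily_mem hB hα hβ) hγ _ _ (by simp; omega)]
    simp
  have zl {j : ℤ} {X : PreFunction R S} (hX : IsFunction B X) := poissonFst_zero_left j hX [] []
  have zr {j : ℤ} {X : PreFunction R S} (hX : IsFunction B X) := poissonFst_zero_right j hX [] []
  by_cases hk : k < 0
  · rw [eq_zero_of_mem_functions_neg hB hα hk, poissonFamily_zero_left hB hβ,
      poissonFamily_zero_left hB hγ, zl (poissonFamily_mem hB hβ hγ).1, zl hγ.1, zr hβ.1]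
    simp
  by_cases hl : l < 0
  · rw [eq_zero_of_mem_functions_neg hB hβ hl, poissonFamily_zero_right hB hα,
      poissonFamily_zero_left hB hγ, zl (poissonFamily_mem hB hα hγ).1, zl hγ.1, zr hα.1]
    simp
  by_cases hm : m < 0
  · rw [eq_zero_of_mem_functions_neg hB hγ hm, poissonFamily_zero_right hB hα,
      poissonFamily_zero_right hB hβ, zr hα.1, zr hβ.1, zr (poissonFamily_mem hB hα hβ).1]
    simp
  clear zl zr
  obtain rfl : m = 4 - k - l := by omega
  have hk' : k ≤ 4 := by omega
  have hl' : l ≤ 4 - k := by omega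
  clear hs hm
  rw [not_lt] at hk hl
  -- the values that can occur in the expansion, each nonzero in one degree only
  have v : ∀ {j : ℤ} {X : PreFunction R S}, X ∈ Functions B j →
      (j ≠ 0 → X.1 [] [] = 0) ∧ (j ≠ 1 → X.2 [] [] = 0) ∧ (j ≠ 2 → ∀ f, X.1 [] [f] = 0) ∧
      (j ≠ 2 → ∀ u, X.2 [u] [] = 0) ∧ (j ≠ 3 → ∀ f, X.2 [] [f] = 0) ∧
      (j ≠ 4 → ∀ f g, X.1 [] [f, g] = 0) := by
    intro j X hX
    refine ⟨fun h => hX.2.1 _ _ ?_, fun h => hX.2.2 _ _ ?_, fun h f => hX.2.1 _ _ ?_,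
      fun h u => hX.2.2 _ _ ?_, fun h f => hX.2.2 _ _ ?_, fun h f g => hX.2.1 _ _ ?_⟩ <;>
      simp <;> omega
  obtain ⟨a1, a2, a3, a4, a5, a6⟩ := v hα
  obtain ⟨b1, b2, b3, b4, b5, b6⟩ := v hβ
  obtain ⟨c1, c2, c3, c4, c5, c6⟩ := v hγ
  clear v
  have p {f g : R} {X : PreFunction R S} (hX : IsFunction B X) :
      X.1 [] [f, g] = X.1 [] [g, f] := hX.perm _ _ _ (.swap _ _ _)
  have t {u v : S} {X : PreFunction R S} (hX : IsFunction B X) :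
      B (X.2 [u] []) v + B (X.2 [v] []) u = X.1 [] [B u v] := by
    rw [hX.pairing, hX.pairing]
    exact hX.swap [] u v [] []
  have n3 : Int.negOnePow 3 = -1 := rfl
  have n4 : Int.negOnePow 4 = 1 := rfl
  simp only [poissonFst, poissonFamily, poissonSnd, bracketFunction]
  interval_cases k <;> interval_cases l <;>
  simp at a1 a2 a3 a4 a5 a6 b1 b2 b3 b4 b5 b6 c1 c2 c3 c4 c5 c6 <;>
  simp [a1, a2, a3, a4, a5, a6, b1, b2, b3, b4, b5, b6, c1, c2, c3, c4, c5, c6, n3, n4,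
    hα.1.apply_zero, hβ.1.apply_zero, hγ.1.apply_zero, hα.1.apply_neg, hβ.1.apply_neg,
    hγ.1.apply_neg]
  · exact p hγ.1
  · exact p hβ.1
  · rw [← t hγ.1, hB.symm (α.2 [] []), hB.symm (β.2 [] [])]
    ring
  · rw [← t hβ.1, hB.symm (α.2 [] [])]
    ring
  · rw [← t hα.1, hB.symm (β.2 [] [])]
  · rw [hB.symm (β.2 [] []), add_neg_cancel]
  · rw [p hα.1, add_neg_cancel]

/-- The graded Jacobi identity `{α, {β, γ}} = {{α, β}, γ} + (-1)ᵏˡ {β, {α, γ}}`. Since `{·, u}` and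
`{·, f}` act as derivations on both sides, it follows from its case of total degree `0`. -/
theorem poissonFst_jacobi (hB : IsMetric B) {k l m : ℤ} {α β γ : PreFunction R S}
    (hα : α ∈ Functions B k) (hβ : β ∈ Functions B l) (hγ : γ ∈ Functions B m)
    (us : List S) (fs : List R) :
    poissonFst B (l + m - 2) α (poissonFamily B m β γ) us fs
      = poissonFst B m (poissonFamily B l α β) γ us fs
        + ((k * l).negOnePow : ℤ) •
          poissonFst B (k + m - 2) β (poissonFamily B m α γ) us fs := by
  induction us generalizing k l m α β γ with
  | nil =>
    induction fs generalizing k l m α β γ with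
    | nil => exact poissonFst_jacobi_nil hB hα hβ hγ
    | cons f fs ih =>
      have hα' := bracketFunction_mem hα f
      have hβ' := bracketFunction_mem hβ f
      have hγ' := bracketFunction_mem hγ f
      simp only [poissonFst]
      rw [bracketFunction_poissonFamily, bracketFunction_poissonFamily,
        bracketFunction_poissonFamily, poissonFst_add_right _ _ _ hα.1,
        poissonFst_add_left _ _ _ hγ.1, poissonFst_add_right _ _ _ hβ.1]
      have h1 := ih hα hβ hγ'
      have h2 := ih hα hβ' hγ
      have h3 := ih hα' hβ hγ
      rw [show l + (m - 2) - 2 = l + m - 2 - 2 by ring,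
        show k + (m - 2) - 2 = k + m - 2 - 2 by ring] at h1
      rw [show l - 2 + m - 2 = l + m - 2 - 2 by ring,
        show k * (l - 2) = k * l - 2 * k by ring, Int.negOnePow_sub,
        Int.negOnePow_even _ (even_two_mul k), mul_one] at h2
      rw [show k - 2 + m - 2 = k + m - 2 - 2 by ring,
        show (k - 2) * l = k * l - 2 * l by ring, Int.negOnePow_sub,
        Int.negOnePow_even _ (even_two_mul l), mul_one] at h3
      rw [h1, h2, h3]
      simp only [smul_add]
      ring
  | cons u us ih =>
    have hα' := bracketSection_mem hα u
    have hβ' := bracketSection_mem hβ u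
    have hγ' := bracketSection_mem hγ u
    simp only [poissonFst]
    rw [bracketSection_poissonFamily, bracketSection_poissonFamily,
      bracketSection_poissonFamily, poissonFst_add_right _ _ _ hα.1,
      poissonFst_add_left _ _ _ hγ.1, poissonFst_add_right _ _ _ hβ.1,
      poissonFst_units_smul_right _ _ _ hα.1, poissonFst_units_smul_left _ _ _ hγ.1,
      poissonFst_units_smul_right _ _ _ hβ.1]
    have h1 := ih hα hβ hγ'
    have h2 := ih hα hβ' hγ
    have h3 := ih hα' hβ hγ
    rw [show l + (m - 1) - 2 = l + m - 2 - 1 by ring,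
      show k + (m - 1) - 2 = k + m - 2 - 1 by ring] at h1
    rw [show l - 1 + m - 2 = l + m - 2 - 1 by ring,
      show k * (l - 1) = k * l - k by ring, Int.negOnePow_sub] at h2
    rw [show k - 1 + m - 2 = k + m - 2 - 1 by ring,
      show (k - 1) * l = k * l - l by ring, Int.negOnePow_sub] at h3
    rw [h1, h2, h3]
    simp only [zsmul_eq_mul, Units.val_mul, Int.cast_mul, Int.negOnePow_add, Int.negOnePow_sub,
      Int.negOnePow_even 2 even_two, mul_one]
    linear_combination (((k * l).negOnePow : ℤ) : R) * ((m.negOnePow : ℤ) : R)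
      * poissonFst B (k + m - 2 - 1) β (poissonFamily B m (bracketSection u α) γ) us fs
      * negOnePow_mul_negOnePow (A := R) l

/-! ### The bracket of homogeneous elements -/

variable {k l m p q r s : ℤ}

theorem Functions.ext_fst (hB : IsMetric B) {α β : Functions B k}
    (h : ∀ us fs, α.1.1 us fs = β.1.1 us fs) : α = β :=
  Subtype.ext <| IsFunction.ext hB α.2.1 β.2.1 <| by
    funext us fs
    exact h us fs

theorem poisson_add_left (hB : IsMetric B) (α α' : Functions B k) (β : Functions B l)
    (h : m = k + l - 2) :
    poisson hB (α + α') β h = poisson hB α β h + poisson hB α' β h :=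
  Functions.ext_fst hB <| poissonFst_add_left l _ _ β.2.1

theorem poisson_add_right (hB : IsMetric B) (α : Functions B k) (β β' : Functions B l)
    (h : m = k + l - 2) :
    poisson hB α (β + β') h = poisson hB α β h + poisson hB α β' h :=
  Functions.ext_fst hB <| poissonFst_add_right l _ _ α.2.1

theorem poisson_zero_right (hB : IsMetric B) (α : Functions B k) (h : m = k + l - 2) :
    poisson hB α (0 : Functions B l) h = 0 :=
  Functions.ext_fst hB <| poissonFst_zero_right l α.2.1

theorem poisson_neg_right (hB : IsMetric B) (α : Functions B k) (β : Functions B l)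
    (h : m = k + l - 2) : poisson hB α (-β) h = -poisson hB α β h :=
  Functions.ext_fst hB <| poissonFst_neg_right l _ α.2.1

theorem poisson_antisymm (hB : IsMetric B) (α : Functions B k) (β : Functions B l)
    (h : m = k + l - 2) (h' : m = l + k - 2) :
    poisson hB α β h = -(((k * l).negOnePow : ℤ) • poisson hB β α h') :=
  Functions.ext_fst hB <| poissonFst_antisymm hB α.2 β.2

/-- The graded Jacobi identity, for the bracket of homogeneous elements. -/
theorem poisson_jacobi (hB : IsMetric B) (α : Functions B k) (β : Functions B l)
    (γ : Functions B m) (h₁ : p = l + m - 2) (h₂ : q = k + l - 2) (h₃ : r = k + m - 2)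
    (hα : s = k + p - 2) (hγ : s = q + m - 2) (hβ : s = l + r - 2) :
    poisson hB α (poisson hB β γ h₁) hα = poisson hB (poisson hB α β h₂) γ hγ
      + ((k * l).negOnePow : ℤ) • poisson hB β (poisson hB α γ h₃) hβ := by
  subst h₁ h₂ h₃
  exact Functions.ext_fst hB <| poissonFst_jacobi hB α.2 β.2 γ.2

/-! ### Deformation by an element of degree 2 -/

/-- `N` acts on `{Θ, Θ} = 0` as a derivation, which gives `2 {Θ, {N, Θ}} = 0`. -/
theorem poisson_deformation_eq_zero (hB : IsMetric B) (N : Functions B 2) (Θ : Functions B 3)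
    (hΘ : poisson hB Θ Θ = (0 : Functions B 4)) :
    poisson hB Θ (poisson hB N Θ : Functions B 3) = (0 : Functions B 4) := by
  have h := poisson_jacobi hB N Θ Θ (p := 4) (q := 3) (r := 3) (s := 4) (by norm_num)
    (by norm_num) (by norm_num) (by norm_num) (by norm_num) (by norm_num)
  rw [hΘ, poisson_zero_right, poisson_antisymm hB (poisson hB N Θ) Θ _ (by norm_num),
    show Int.negOnePow (3 * 3) = -1 from rfl, show Int.negOnePow (2 * 3) = 1 from rfl] at h
  simp only [Units.val_neg, Units.val_one, neg_smul, one_smul, neg_neg] at h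
  -- `2` is invertible in `R`, being the image of a nonzero real number
  have h2 : (algebraMap ℝ R 2) • poisson hB Θ (poisson hB N Θ : Functions B 3)
      = (0 : Functions B 4) := by
    rw [h, map_ofNat, ofNat_smul_eq_nsmul, two_nsmul]
  rw [← one_smul R (poisson hB Θ _), ← map_one (algebraMap ℝ R),
    show (1 : ℝ) = 1 / 2 * 2 by norm_num, map_mul, mul_smul, h2, smul_zero]

/-- `{Θ', Θ'} = {Θ, {Θ', N}}` for `Θ' = {N, Θ}`: apply the derivation `{N, ·}` to
`{Θ, Θ'} = 0`. -/
theorem poisson_deformation_self (hB : IsMetric B) (N : Functions B 2) (Θ : Functions B 3)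
    (hΘ : poisson hB Θ Θ = (0 : Functions B 4)) :
    (poisson hB (poisson hB N Θ : Functions B 3) (poisson hB N Θ : Functions B 3) : Functions B 4)
      = poisson hB Θ (poisson hB (poisson hB N Θ : Functions B 3) N : Functions B 3) := by
  have h := poisson_jacobi hB N Θ (poisson hB N Θ : Functions B 3) (p := 4) (q := 3) (r := 3)
    (s := 4) (by norm_num) (by norm_num) (by norm_num) (by norm_num) (by norm_num) (by norm_num)
  rw [poisson_deformation_eq_zero hB N Θ hΘ, poisson_zero_right,
    show Int.negOnePow (2 * 3) = 1 from rfl, Units.val_one, one_smul] at h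
  rw [poisson_antisymm hB (poisson hB N Θ : Functions B 3) N _ (by norm_num),
    show Int.negOnePow (3 * 2) = 1 from rfl, Units.val_one, one_smul, poisson_neg_right]
  exact eq_neg_of_add_eq_zero_left h.symm

theorem poisson_add_deformation_self (hB : IsMetric B) (N : Functions B 2) (Θ : Functions B 3)
    (hΘ : poisson hB Θ Θ = (0 : Functions B 4)) :
    (poisson hB (Θ + poisson hB N Θ) (Θ + poisson hB N Θ) : Functions B 4)
      = poisson hB (poisson hB N Θ : Functions B 3) (poisson hB N Θ : Functions B 3) := by
  rw [poisson_add_left, poisson_add_right, poisson_add_right, hΘ,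
    poisson_antisymm hB (poisson hB N Θ) Θ _ (by norm_num),
    poisson_deformation_eq_zero hB N Θ hΘ, smul_zero, neg_zero, zero_add, zero_add, zero_add]

end GradedLie

end SymplecticRealization

theorem theorem3p3 {n : ℕ} {M : Type*} [TopologicalSpace M] [T2Space M]
    [SecondCountableTopology M] [ChartedSpace (EuclideanSpace ℝ (Fin n)) M] [IsManifold (𝓡 n) ∞ M]
    {F : Type*} [NormedAddCommGroup F] [NormedSpace ℝ F] [FiniteDimensional ℝ F]
    {E : M → Type*} [TopologicalSpace (Bundle.TotalSpace F E)] [∀ x, TopologicalSpace (E x)]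
    [∀ x, AddCommGroup (E x)] [∀ x, Module ℝ (E x)] [FiberBundle F E] [VectorBundle ℝ F E]
    [ContMDiffVectorBundle ∞ F E (𝓡 n)]
    (g : SymplecticRealization.FiberMetric n F E) (Θ : g.A 3)
    (hΘ : SymplecticRealization.FiberMetric.IsCourantStructure Θ)
    (N : SymplecticRealization.SkewEndomorphism g) :
    (SymplecticRealization.FiberMetric.IsCourantStructure (N.deformation Θ) ↔
      N.IsWeakDeforming Θ) ∧
    (N.IsWeakDeforming Θ →
      SymplecticRealization.FiberMetric.Compatible Θ (N.deformation Θ)) := by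
  have hself := SymplecticRealization.poisson_deformation_self g.isMetric N.tilde Θ hΘ
  have hiff : SymplecticRealization.FiberMetric.IsCourantStructure (N.deformation Θ) ↔
      N.IsWeakDeforming Θ :=
    ⟨fun h => hself.symm.trans h, fun h => hself.trans h⟩
  exact ⟨hiff, fun h =>
    (SymplecticRealization.poisson_add_deformation_self g.isMetric N.tilde Θ hΘ).trans
      (hiff.2 h)⟩
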